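/- **Proposition (Area law).** Let $G$ be a finite connected simple graph with vertex set $V$ (the lattice), with a spin-$1/2$ particle, i.e. a copy of $\mathbb{C}^2$, at every vertex. For every edge $e=\{a,b\}$ of $G$ let $h_e$ be a Hermitian operator on the two spins $a,b$, and let $H=\sum_e h_e\otimes 1$ on $(\mathbb{C}^2)^{\otimes V}$. The ground space of a Hermitian operator is the eigenspace of its smallest eigenvalue. Assume that $H$ is *natural*: for every edge $e$ there is an entangled (i.e. non-product) vector in $\mathbb{C}^2\otimes\mathbb{C}^2$ orthogonal to the ground space of $h_e$; and *unfrustrated*: every vector in the ground space $M$ of $H$ lies in the ground space of $h_e\otimes 1$ for every $e$. Let $\rho=P_M/\dim M$ be the maximally mixed state over $M$. For $A\subseteq V$ let $\partial A$ be the set of edges between $A$ and $V\setminus A$, and let $\alpha(A)$ be the number of vertices of $A$ that are adjacent to a vertex outside $A$. The lattice is of finite dimension with constants $c,K>0$ if $\alpha(A)\ge K|A|^c$ for every non-empty $A\subseteq V$ which induces a connected subgraph and has $|A|\le |V|/2$. The entanglement of formation of $\rho$ across $A:V\setminus A$ is $$E_F(\rho)=\inf\Big\{\sum_i p_i\,S\big(\mathrm{Tr}_{V\setminus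 A}|\psi_i\rangle\langle\psi_i|\big)\ :\ \rho=\sum_i p_i|\psi_i\rangle\langle\psi_i|\Big\},$$ where the infimum is over finite ensembles of unit vectors $\psi_i$ with probabilities $p_i$, and $S(\sigma)=-\mathrm{Tr}\,\sigma\log_2\sigma$. For all $c,K>0$ there is a constant $C>0$, depending only on $c$ and $K$ (in particular, neither on the size of the lattice, nor on $H$, nor on $A$), such that for every lattice $G$ of finite dimension with constants $c,K$, every unfrustrated natural Hamiltonian $H$ on $G$, and every subsystem $A\subseteq V$, $$E_F(\rho)\le C\,|\partial A| .$$ -/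

import Mathlib

open scoped Matrix

noncomputable section

namespace SpinLattice

/-! ### Linear algebra: ground spaces, states, entanglement of formation -/

/-- The Hilbert space `(ℂ²)^{⊗ S}` of a finite set `S` of spin-1/2 particles, written in the
computational basis (which is indexed by the configurations `S → {0,1}`). -/
abbrev SpinSpace (S : Type*) [Fintype S] := EuclideanSpace ℂ (S → Fin 2)

/-- Operators on `(ℂ²)^{⊗ S}`, as matrices in the computational basis. -/
abbrev SpinOp (S : Type*) := Matrix (S → Fin 2) (S → Fin 2) ℂ

/-- The ground energy of a Hermitian matrix: its smallest eigenvalue. -/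
def groundEnergy {n : Type*} [Fintype n] [DecidableEq n] (X : Matrix n n ℂ) : ℝ :=
  sInf (spectrum ℝ X)

/-- The ground-state manifold of a Hermitian matrix: the eigenspace of the smallest eigenvalue. -/
def groundSpace {n : Type*} [Fintype n] [DecidableEq n] (X : Matrix n n ℂ) :
    Submodule ℂ (EuclideanSpace ℂ n) :=
  Module.End.eigenspace (Matrix.toEuclideanLin X) (groundEnergy X : ℂ)

/-- The maximally mixed state `P_M / dim M` over a subspace `M`. -/
def maximallyMixed {n : Type*} [Fintype n] [DecidableEq n]
    (M : Submodule ℂ (EuclideanSpace ℂ n)) : Matrix n n ℂ :=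
  (Module.finrank ℂ M : ℂ)⁻¹ •
    Matrix.toEuclideanLin.symm (M.starProjection : EuclideanSpace ℂ n →ₗ[ℂ] EuclideanSpace ℂ n)

/-- The rank-one operator `|ψ⟩⟨ψ|`. -/
def pureState {n : Type*} (ψ : EuclideanSpace ℂ n) : Matrix n n ℂ :=
  Matrix.of fun x y => ψ x * star (ψ y)

/-- A vector is a product vector if it is of the form `⨂_v f_v`; otherwise it is entangled. -/
def IsProductVector {S : Type*} [Fintype S] (φ : SpinSpace S) : Prop :=
  ∃ f : S → Fin 2 → ℂ, ∀ x : S → Fin 2, φ x = ∏ v, f v (x v)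

/-- The von Neumann entropy `-Tr σ log₂ σ` of a Hermitian matrix, in e-bits. -/
def vonNeumannEntropy {n : Type*} [Fintype n] [DecidableEq n] {σ : Matrix n n ℂ}
    (hσ : σ.IsHermitian) : ℝ :=
  ∑ i, -(hσ.eigenvalues i * Real.logb 2 (hσ.eigenvalues i))

section Bipartite

variable {V : Type*} [Fintype V] [DecidableEq V]

/-- The coefficients of a vector `ψ ∈ (ℂ²)^{⊗ V}` as a matrix whose rows are the configurations
of `A` and whose columns are the configurations of `V ∖ A`. -/
def coeffMatrix (A : Finset V) (ψ : SpinSpace V) :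
    Matrix ({v // v ∈ A} → Fin 2) ({v // v ∉ A} → Fin 2) ℂ :=
  Matrix.of fun x y => ψ ((Equiv.piEquivPiSubtypeProd (· ∈ A) (fun _ => Fin 2)).symm (x, y))

/-- The reduced state `Tr_{V∖A} |ψ⟩⟨ψ|`: its entry at `(x, x')` is
`∑ y, ψ (x, y) * conj (ψ (x', y))`. -/
def reducedState (A : Finset V) (ψ : SpinSpace V) : SpinOp {v // v ∈ A} :=
  coeffMatrix A ψ * (coeffMatrix A ψ)ᴴ

theorem reducedState_isHermitian (A : Finset V) (ψ : SpinSpace V) :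
    (reducedState A ψ).IsHermitian :=
  Matrix.isHermitian_mul_conjTranspose_self _

/-- The entropy of entanglement of a pure state across `A : V ∖ A`. -/
def entanglementEntropy (A : Finset V) (ψ : SpinSpace V) : ℝ :=
  vonNeumannEntropy (reducedState_isHermitian A ψ)

/-- A finite ensemble of pure states that realizes the mixed state `ρ`. -/
structure PureEnsemble (ρ : SpinOp V) where
  /-- the number of members -/
  size : ℕ
  /-- the probabilities -/
  prob : Fin size → ℝ
  /-- the state vectors -/
  vec : Fin size → SpinSpace V
  prob_nonneg : ∀ i, 0 ≤ prob i
  sum_prob : ∑ i, prob i = 1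
  norm_vec : ∀ i, ‖vec i‖ = 1
  mixture : ∑ i, (prob i : ℂ) • pureState (vec i) = ρ

/-- The entanglement of formation of `ρ` across `A : V ∖ A`: the infimum, over all pure-state
ensembles that realize `ρ`, of the average entropy of entanglement (`⊤` if there is no ensemble,
that is, if `ρ` is not a density matrix). -/
def entanglementOfFormation (A : Finset V) (ρ : SpinOp V) : EReal :=
  ⨅ e : PureEnsemble ρ, ((∑ i, e.prob i * entanglementEntropy A (e.vec i) : ℝ) : EReal)

end Bipartite

/-! ### Hamiltonians with nearest-neighbour terms -/

section Hamiltonian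

variable {V : Type*} [Fintype V] [DecidableEq V]

/-- The operator `h ⊗ 1` on all spins, for an operator `h` on the two spins of the pair `e`. -/
def extendPair (e : Sym2 V) (h : SpinOp {v // v ∈ e}) : SpinOp V :=
  Matrix.of fun x y =>
    if ∀ v, v ∉ e → x v = y v then h (fun v => x v) (fun v => y v) else 0

/-- A 2-local spin-1/2 Hamiltonian `H = ∑ h_{a,b}` with interaction graph `G`: one Hermitian
two-spin term for every edge `{a,b}`. The ground energies of the terms need not be zero. -/
structure PairHamiltonian (G : SimpleGraph V) where
  /-- the term on the two spins of an edge -/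
  term : ∀ e : G.edgeSet, SpinOp {v // v ∈ (e : Sym2 V)}
  isHermitian : ∀ e, (term e).IsHermitian

namespace PairHamiltonian

variable {G : SimpleGraph V}

/-- The term of an edge as an operator on the whole system. -/
def globalTerm (H : PairHamiltonian G) (e : G.edgeSet) : SpinOp V :=
  extendPair (e : Sym2 V) (H.term e)

/-- The total Hamiltonian. -/
def total [DecidableRel G.Adj] (H : PairHamiltonian G) : SpinOp V :=
  ∑ e : G.edgeSet, H.globalTerm e

/-- Natural: there are no isolated subsystems (the interaction graph is connected), and each term
has an entangled excited state, i.e. an entangled vector orthogonal to its ground space. -/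
structure IsNatural (H : PairHamiltonian G) : Prop where
  connected : G.Connected
  entangled : ∀ e : G.edgeSet, ∃ φ ∈ (groundSpace (H.term e))ᗮ, ¬ IsProductVector φ

/-- Unfrustrated: every ground state vector of `H` is a ground state vector of every term. -/
def IsUnfrustrated [DecidableRel G.Adj] (H : PairHamiltonian G) : Prop :=
  ∀ e : G.edgeSet, groundSpace H.total ≤ groundSpace (H.globalTerm e)

/-- The ground state: the maximally mixed state over the ground-state manifold. -/
def groundState [DecidableRel G.Adj] (H : PairHamiltonian G) : SpinOp V :=
  maximallyMixed (groundSpace H.total)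

end PairHamiltonian

end Hamiltonian

/-! ### Lattices -/

section Lattice

variable {V : Type*} [Fintype V] [DecidableEq V] (G : SimpleGraph V) [DecidableRel G.Adj]

/-- The spins of `A` that are adjacent to spins outside `A`. -/
def boundarySpins (A : Finset V) : Finset V :=
  A.filter fun a => ∃ b, b ∉ A ∧ G.Adj a b

/-- `|∂A|`: the number of edges between `A` and its complement. -/
def boundaryArea (A : Finset V) : ℕ :=
  (G.interedges A Aᶜ).card

/-- The finite lattice `G` obeys the isoperimetric inequality of a finite-dimensional lattice with
constants `c` and `K`: a contiguous region of `n` spins that fills at most half of the system has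
at least `K * n ^ c` boundary spins. (Box-shaped pieces and tori of `ℤ^d`, `d ≥ 2`, obey it with
`c = (d - 1) / d` and `K` independent of their size.) -/
def IsoperimetricBound (c K : ℝ) : Prop :=
  ∀ A : Finset V, (G.induce (A : Set V)).Connected → 2 * A.card ≤ Fintype.card V →
    K * (A.card : ℝ) ^ c ≤ ((boundarySpins G A).card : ℝ)

end Lattice

end SpinLattice

end

/-!
An entangled two-spin functional is an invertible `2 × 2` matrix `B`, and every ground vector is
annihilated by one such functional on each edge. Applying `g v` to the spin `v` replaces the
constraint `(g a)ᵀ * J * g b` on an edge `{a, b}` by `J`. Along a spanning tree one can therefore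
choose the `g v` recursively so that all tree constraints become the singlet. Annihilation by the
singlet on `{a, b}` means invariance under the transposition of `a` and `b`, and the tree
transpositions generate all permutations: up to invertible one-spin operators, a ground vector is
symmetric. A symmetric vector depends on the number of ones only, so across `A : V ∖ A` its Schmidt
rank is at most `min |A| |V ∖ A| + 1`, and its entropy at most the logarithm of that. This bounds
`E_F` through the ensemble of an orthonormal basis of the ground space.

If `S` fills at most half of the lattice, `log₂ (|S| + 1)` is at most a constant times `|∂S|`. For
connected `S` this is the isoperimetric inequality, as a logarithm grows slower than any power. The
general case follows by cutting off connected components, because `|∂S|` is additive over components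
and `n ↦ log₂ (n + 1)` is subadditive.
-/

namespace SpinLattice

/-! ### Isoperimetry -/

section Isoperimetry

theorem exists_connected_induce_of_nonempty {V : Type*} [DecidableEq V] (G : SimpleGraph V)
    {S : Finset V} (hS : S.Nonempty) :
    ∃ T ⊆ S, (G.induce (T : Set V)).Connected ∧ ∀ a ∈ T, ∀ b ∈ S \ T, ¬ G.Adj a b := by
  classical
  obtain ⟨v, hv⟩ := hS
  have hne : (S.powerset.filter fun T : Finset V => (G.induce (T : Set V)).Connected).Nonempty := by
    refine ⟨{v}, Finset.mem_filter.2 ⟨by simpa using hv, ?_⟩⟩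
    rw [Finset.coe_singleton]
    exact .mk .of_subsingleton
  obtain ⟨T, hT, hmax⟩ := Finset.exists_maximal hne
  obtain ⟨hTS, hconn⟩ := Finset.mem_filter.1 hT
  rw [Finset.mem_powerset] at hTS
  refine ⟨T, hTS, hconn, fun a ha b hb hab => ?_⟩
  obtain ⟨hbS, hbT⟩ := Finset.mem_sdiff.1 hb
  have hconn' : (G.induce (insert b T : Finset V)).Connected := by
    have h := SimpleGraph.induce_union_connected
      (SimpleGraph.induce_pair_connected_of_adj hab).preconnected hconn.preconnected
      ⟨a, by simp, ha⟩
    rwa [Set.insert_union, Set.singleton_union, Set.insert_comm,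
      Set.insert_eq_of_mem (Finset.mem_coe.2 ha), ← Finset.coe_insert] at h
  have hins : insert b T ⊆ T := hmax
    (Finset.mem_filter.2 ⟨Finset.mem_powerset.2 (Finset.insert_subset hbS hTS), hconn'⟩)
    (Finset.subset_insert b T)
  exact hbT (hins (Finset.mem_insert_self b T))

variable {V : Type*} [Fintype V] [DecidableEq V] (G : SimpleGraph V) [DecidableRel G.Adj]

theorem card_boundarySpins_le_boundaryArea (A : Finset V) :
    (boundarySpins G A).card ≤ boundaryArea G A := by
  have h : boundarySpins G A ⊆ (G.interedges A Aᶜ).image Prod.fst := by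
    intro a ha
    obtain ⟨haA, b, hb, hab⟩ := Finset.mem_filter.1 ha
    exact Finset.mem_image_of_mem Prod.fst
      ((G.mem_interedges_iff (x := (a, b))).2 ⟨haA, Finset.mem_compl.2 hb, hab⟩)
  exact (Finset.card_le_card h).trans Finset.card_image_le

theorem boundaryArea_compl (A : Finset V) : boundaryArea G Aᶜ = boundaryArea G A := by
  have : Std.Symm G.Adj := ⟨fun _ _ h => h.symm⟩
  rw [boundaryArea, compl_compl]
  exact Rel.card_interedges_comm Aᶜ A

theorem boundaryArea_eq_add {S T : Finset V} (hTS : T ⊆ S)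
    (hsep : ∀ a ∈ T, ∀ b ∈ S \ T, ¬ G.Adj a b) :
    boundaryArea G S = boundaryArea G T + boundaryArea G (S \ T) := by
  have hunion : G.interedges S Sᶜ = G.interedges T Tᶜ ∪ G.interedges (S \ T) (S \ T)ᶜ := by
    ext ⟨a, b⟩
    have hTa := @hTS a
    have hTb := @hTS b
    have hab := hsep a
    have hba := hsep b
    have hcomm := G.adj_comm a b
    simp only [Finset.mem_union, SimpleGraph.mem_interedges_iff, Finset.mem_compl,
      Finset.mem_sdiff] at hab hba ⊢
    grind
  have hdisj : Disjoint (G.interedges T Tᶜ) (G.interedges (S \ T) (S \ T)ᶜ) := by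
    rw [Finset.disjoint_left]
    rintro ⟨a, b⟩ hT hST
    rw [SimpleGraph.mem_interedges_iff] at hT hST
    exact (Finset.mem_sdiff.1 hST.1).2 hT.1
  rw [boundaryArea, hunion, Finset.card_union_of_disjoint hdisj]
  rfl

theorem le_mul_boundaryArea_of_subadditive {f : ℕ → ℝ} (hf0 : f 0 = 0)
    (hf : ∀ m n, f (m + n) ≤ f m + f n) {κ : ℝ} {N : ℕ}
    (hconn : ∀ T : Finset V, (G.induce (T : Set V)).Connected → T.card ≤ N →
      f T.card ≤ κ * boundaryArea G T)
    (S : Finset V) (hS : S.card ≤ N) : f S.card ≤ κ * boundaryArea G S := by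
  induction S using Finset.strongInduction with
  | H S ih =>
    rcases S.eq_empty_or_nonempty with rfl | hne
    · simp [hf0, boundaryArea]
    obtain ⟨T, hTS, hTconn, hsep⟩ := exists_connected_induce_of_nonempty G hne
    have hTne : T.Nonempty := Finset.coe_nonempty.1 (Set.nonempty_coe_sort.1 hTconn.nonempty)
    have hcard : T.card + (S \ T).card = S.card := by
      rw [add_comm, Finset.card_sdiff_add_card_eq_card hTS]
    calc f S.card ≤ f T.card + f (S \ T).card := hcard ▸ hf _ _
      _ ≤ κ * boundaryArea G T + κ * boundaryArea G (S \ T) :=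
        add_le_add (hconn T hTconn (by omega))
          (ih _ (Finset.sdiff_ssubset hTS hTne) (by omega))
      _ = κ * boundaryArea G S := by
        rw [boundaryArea_eq_add G hTS hsep, Nat.cast_add, mul_add]

theorem logb_two_add_one_le_rpow {c x : ℝ} (hc : 0 < c) (hx : 1 ≤ x) :
    Real.logb 2 (x + 1) ≤ 2 ^ c / (c * Real.log 2) * x ^ c := by
  have hlog2 : 0 < Real.log 2 := Real.log_pos one_lt_two
  rw [Real.logb, div_le_iff₀ hlog2]
  calc Real.log (x + 1) ≤ Real.log (2 * x) := Real.log_le_log (by linarith) (by linarith)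
    _ ≤ (2 * x) ^ c / c := Real.log_le_rpow_div (by linarith) hc
    _ = 2 ^ c / (c * Real.log 2) * x ^ c * Real.log 2 := by
      rw [Real.mul_rpow zero_le_two (by linarith)]
      field_simp

theorem logb_two_natCast_add_add_one_le (m n : ℕ) :
    Real.logb 2 ((m + n : ℕ) + 1) ≤ Real.logb 2 (m + 1) + Real.logb 2 (n + 1) := by
  rw [← Real.logb_mul (by positivity) (by positivity)]
  refine Real.logb_le_logb_of_le one_lt_two (by positivity) ?_
  push_cast
  nlinarith [mul_nonneg (m.cast_nonneg (α := ℝ)) (n.cast_nonneg (α := ℝ))]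

/-- The constant of the area law in a lattice with isoperimetric constants `c` and `K`. -/
noncomputable def areaLawConst (c K : ℝ) : ℝ := 2 ^ c / (c * Real.log 2) / K

theorem areaLawConst_pos {c K : ℝ} (hc : 0 < c) (hK : 0 < K) : 0 < areaLawConst c K := by
  have hden : 0 < c * Real.log 2 := mul_pos hc (Real.log_pos one_lt_two)
  exact div_pos (div_pos (Real.rpow_pos_of_pos two_pos c) hden) hK

namespace IsoperimetricBound

variable {G} {c K : ℝ} (hG : IsoperimetricBound G c K) (hc : 0 < c) (hK : 0 < K)
include hG hc hK

theorem logb_card_add_one_le_of_connected {T : Finset V}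
    (hconn : (G.induce (T : Set V)).Connected) (hT : 2 * T.card ≤ Fintype.card V) :
    Real.logb 2 (T.card + 1) ≤ areaLawConst c K * boundaryArea G T := by
  have hcard : (1 : ℝ) ≤ T.card := by
    exact_mod_cast (Finset.coe_nonempty.1 (Set.nonempty_coe_sort.1 hconn.nonempty)).card_pos
  calc Real.logb 2 (T.card + 1) ≤ 2 ^ c / (c * Real.log 2) * (T.card : ℝ) ^ c :=
        logb_two_add_one_le_rpow hc hcard
    _ = areaLawConst c K * (K * (T.card : ℝ) ^ c) := by
      rw [areaLawConst]
      field_simp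
    _ ≤ areaLawConst c K * boundaryArea G T := by
      refine mul_le_mul_of_nonneg_left ((hG T hconn hT).trans ?_) (areaLawConst_pos hc hK).le
      exact_mod_cast card_boundarySpins_le_boundaryArea G T

theorem logb_card_add_one_le {S : Finset V} (hS : 2 * S.card ≤ Fintype.card V) :
    Real.logb 2 (S.card + 1) ≤ areaLawConst c K * boundaryArea G S :=
  le_mul_boundaryArea_of_subadditive G (f := fun n => Real.logb 2 (n + 1)) (by simp)
    logb_two_natCast_add_add_one_le (N := Fintype.card V / 2)
    (fun _ hconn hT => hG.logb_card_add_one_le_of_connected hc hK hconn (by omega)) S (by omega)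

theorem logb_min_card_add_one_le (A : Finset V) :
    Real.logb 2 ((min A.card Aᶜ.card : ℕ) + 1) ≤ areaLawConst c K * boundaryArea G A := by
  have hcard := A.card_add_card_compl
  rcases le_total A.card Aᶜ.card with h | h
  · rw [min_eq_left h]
    exact hG.logb_card_add_one_le hc hK (by omega)
  · rw [min_eq_right h, ← boundaryArea_compl]
    exact hG.logb_card_add_one_le hc hK (by omega)

end IsoperimetricBound

end Isoperimetry

/-! ### Slices of vectors and product operators -/

section Slices

variable {V κ R : Type*} (p : V → Prop) [DecidablePred p]

/-- The configuration of the sites `V` that agrees with `x` on the sites satisfying `p` and with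
`y` on the other sites. -/
def glue (x : {v // p v} → κ) (y : {v // ¬ p v} → κ) : V → κ :=
  (Equiv.piEquivPiSubtypeProd p fun _ => κ).symm (x, y)

@[simp]
theorem glue_apply_pos (x : {v // p v} → κ) (y : {v // ¬ p v} → κ) (v : {v // p v}) :
    glue p x y v = x v := dif_pos v.2

@[simp]
theorem glue_apply_neg (x : {v // p v} → κ) (y : {v // ¬ p v} → κ) (v : {v // ¬ p v}) :
    glue p x y v = y v := dif_neg v.2

theorem glue_restrict (z : V → κ) : glue p (fun v => z v) (fun v => z v) = z :=
  (Equiv.piEquivPiSubtypeProd p fun _ => κ).symm_apply_apply z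

theorem sum_glue {M : Type*} [AddCommMonoid M] [Fintype ({v // p v} → κ)]
    [Fintype ({v // ¬ p v} → κ)] [Fintype (V → κ)] (f : (V → κ) → M) :
    ∑ x, ∑ y, f (glue p x y) = ∑ z, f z := by
  rw [← Fintype.sum_prod_type' fun x y => f (glue p x y)]
  exact (Equiv.piEquivPiSubtypeProd p fun _ => κ).symm.sum_comp f

/-- The coefficients of a vector as a matrix, with rows indexed by the configurations of the sites
satisfying `p` and columns by those of the other sites. It is a Schmidt matrix when `p` cuts out a
region, and its columns are two-spin vectors when `p` cuts out a pair. -/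
def sliceMatrix (ψ : (V → κ) → R) : Matrix ({v // p v} → κ) ({v // ¬ p v} → κ) R :=
  Matrix.of fun x y => ψ (glue p x y)

theorem sliceMatrix_injective :
    Function.Injective (sliceMatrix p : ((V → κ) → R) → Matrix _ _ R) := by
  intro ψ χ h
  funext z
  rw [← glue_restrict p z]
  exact congrFun₂ h _ _

variable {S : Type*} [Fintype S] [DecidableEq S] [Fintype κ] [DecidableEq κ]

/-- The product operator `⨂ v, g v`, as a monoid homomorphism in the family `g`. -/
def productOp [CommSemiring R] : (S → Matrix κ κ R) →* Matrix (S → κ) (S → κ) R where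
  toFun g := Matrix.of fun x y => ∏ v, g v (x v) (y v)
  map_one' := by
    ext x y
    simp only [Matrix.of_apply, Pi.one_apply, Matrix.one_apply, Finset.prod_ite_zero]
    simp [funext_iff]
  map_mul' g h := by
    ext x y
    simp only [Pi.mul_apply, Matrix.mul_apply, Matrix.of_apply, Finset.prod_univ_sum,
      Fintype.piFinset_univ, Finset.prod_mul_distrib]

theorem productOp_apply [CommSemiring R] (g : S → Matrix κ κ R) (x y : S → κ) :
    productOp g x y = ∏ v, g v (x v) (y v) := rfl

theorem isUnit_productOp [CommSemiring R] {g : S → Matrix κ κ R} (hg : ∀ v, IsUnit (g v)) :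
    IsUnit (productOp g) :=
  (Pi.isUnit_iff.2 hg).map productOp

variable [Fintype V] [DecidableEq V]

theorem sliceMatrix_productOp_mulVec [CommSemiring R] (g : V → Matrix κ κ R) (ψ : (V → κ) → R) :
    sliceMatrix p (productOp g *ᵥ ψ) =
      productOp (fun v : {v // p v} => g v) * sliceMatrix p ψ *
        (productOp fun v : {v // ¬ p v} => g v)ᵀ := by
  ext x y
  simp only [sliceMatrix, Matrix.of_apply, Matrix.mul_apply, Matrix.transpose_apply,
    Matrix.mulVec, dotProduct, Finset.sum_mul]
  rw [Finset.sum_comm, ← sum_glue p]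
  refine Finset.sum_congr rfl fun x' _ => Finset.sum_congr rfl fun y' _ => ?_
  simp only [productOp_apply, ← Fintype.prod_subtype_mul_prod_subtype p, glue_apply_pos,
    glue_apply_neg]
  ring

theorem rank_sliceMatrix_productOp_mulVec [CommRing R] {g : V → Matrix κ κ R}
    (hg : ∀ v, IsUnit (g v)) (ψ : (V → κ) → R) :
    (sliceMatrix p (productOp g *ᵥ ψ)).rank = (sliceMatrix p ψ).rank := by
  have hrow : IsUnit (productOp fun v : {v // p v} => g v) := isUnit_productOp fun v => hg v
  have hcol : IsUnit (productOp fun v : {v // ¬ p v} => g v) := isUnit_productOp fun v => hg v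
  rw [sliceMatrix_productOp_mulVec, Matrix.rank_mul_eq_left_of_isUnit_det,
    Matrix.rank_mul_eq_right_of_isUnit_det]
  · exact (Matrix.isUnit_iff_isUnit_det _).1 hrow
  · rw [Matrix.det_transpose]
    exact (Matrix.isUnit_iff_isUnit_det _).1 hcol

end Slices

/-! ### Permutation symmetric vectors -/

section Symmetric

variable {V : Type*}

/-- The permutations of the sites that leave a vector invariant. -/
def invariantPerms {κ R : Type*} (χ : (V → κ) → R) : Submonoid (Equiv.Perm V) where
  carrier := {σ | ∀ x, χ (x ∘ σ) = χ x}
  one_mem' _ := rfl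
  mul_mem' {σ τ} hσ hτ x := by rw [Equiv.Perm.coe_mul, ← Function.comp_assoc, hτ, hσ]

variable [Fintype V]

theorem exists_perm_comp_eq_of_hammingNorm_eq {x y : V → Fin 2}
    (h : hammingNorm x = hammingNorm y) : ∃ σ : Equiv.Perm V, x ∘ σ = y := by
  obtain ⟨σ, hσ⟩ := Equiv.Perm.exists_map_finset_eq _ _ h.symm
  refine ⟨σ, funext fun v => ?_⟩
  have hv : x (σ v) ≠ 0 ↔ y v ≠ 0 := by
    simpa using (Finset.ext_iff.1 hσ (σ v)).symm
  simp only [Function.comp_apply]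
  omega

variable (p : V → Prop) [DecidablePred p]

theorem hammingNorm_glue {κ : Type*} [Zero κ] [DecidableEq κ] (x : {v // p v} → κ)
    (y : {v // ¬ p v} → κ) : hammingNorm (glue p x y) = hammingNorm x + hammingNorm y := by
  simp only [hammingNorm, Finset.card_filter, ← Fintype.sum_subtype_add_sum_subtype p,
    glue_apply_pos, glue_apply_neg]

theorem rank_sliceMatrix_le_of_symmetric [DecidableEq V] {R : Type*} [CommRing R] [Nontrivial R]
    {χ : (V → Fin 2) → R} (hχ : invariantPerms χ = ⊤) :
    (sliceMatrix p χ).rank ≤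
      min (Fintype.card {v // p v}) (Fintype.card {v // ¬ p v}) + 1 := by
  obtain ⟨f, hf⟩ : ∃ f : ℕ → R, χ = f ∘ (hammingNorm : (V → Fin 2) → ℕ) := by
    refine (Function.factorsThrough_iff χ).1 fun x y hxy => ?_
    obtain ⟨σ, rfl⟩ := exists_perm_comp_eq_of_hammingNorm_eq hxy
    have hσ : σ ∈ invariantPerms χ := hχ ▸ Submonoid.mem_top σ
    exact (hσ x).symm
  let hankel : Matrix (Fin (Fintype.card {v // p v} + 1)) (Fin (Fintype.card {v // ¬ p v} + 1)) R :=
    Matrix.of fun i j => f (i + j)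
  have hslice : sliceMatrix p χ =
      hankel.submatrix (fun x => ⟨hammingNorm x, Nat.lt_succ_of_le hammingNorm_le_card_fintype⟩)
        fun y => ⟨hammingNorm y, Nat.lt_succ_of_le hammingNorm_le_card_fintype⟩ := by
    ext x y
    rw [hf]
    exact congrArg f (hammingNorm_glue p x y)
  rw [hslice, ← min_add_add_right]
  refine (Matrix.rank_submatrix_le _ _ _).trans (le_min ?_ ?_)
  · simpa using hankel.rank_le_card_height
  · simpa using hankel.rank_le_card_width

end Symmetric

/-! ### Pair functionals -/

section PairFunctionals

variable {V κ R : Type*} {a b : V}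

/-- The coefficients `B` of a vector or functional on two sites, as a function of the configuration
of the pair `s(a, b)`: rows belong to `a` and columns to `b`. -/
def pairVec (a b : V) (B : Matrix κ κ R) (w : {v // v ∈ s(a, b)} → κ) : R :=
  B (w ⟨a, Sym2.mem_mk_left a b⟩) (w ⟨b, Sym2.mem_mk_right a b⟩)

/-- The configurations of the pair `s(a, b)`, listed by the values at `a` and at `b`. -/
def pairConfigEquiv [DecidableEq V] (hab : a ≠ b) : κ × κ ≃ ({v // v ∈ s(a, b)} → κ) where
  toFun ij v := if (v : V) = a then ij.1 else ij.2
  invFun w := (w ⟨a, Sym2.mem_mk_left a b⟩, w ⟨b, Sym2.mem_mk_right a b⟩)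
  left_inv ij := by simp [hab.symm]
  right_inv w := by
    funext ⟨v, hv⟩
    rcases Sym2.mem_iff.1 hv with rfl | rfl
    · simp
    · simp [hab.symm]

theorem pairVec_surjective (hab : a ≠ b) :
    Function.Surjective (pairVec a b : Matrix κ κ R → _) := by
  classical
  exact fun φ => ⟨Matrix.of fun i j => φ (pairConfigEquiv hab (i, j)),
    funext fun w => congrArg φ ((pairConfigEquiv hab).apply_symm_apply w)⟩

theorem prod_pair {M : Type*} [CommMonoid M] [Fintype {v // v ∈ s(a, b)}] (hab : a ≠ b)
    (f : {v // v ∈ s(a, b)} → M) :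
    ∏ v, f v = f ⟨a, Sym2.mem_mk_left a b⟩ * f ⟨b, Sym2.mem_mk_right a b⟩ := by
  classical
  have huniv : (Finset.univ : Finset {v // v ∈ s(a, b)}) =
      {⟨a, Sym2.mem_mk_left a b⟩, ⟨b, Sym2.mem_mk_right a b⟩} := by
    ext ⟨v, hv⟩
    simpa using hv
  rw [huniv, Finset.prod_pair (by simpa using hab)]

variable [DecidableEq V]

theorem pairConfigEquiv_restrict (hab : a ≠ b) (z : V → κ) :
    pairConfigEquiv hab (z a, z b) = fun v : {v // v ∈ s(a, b)} => z v :=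
  (pairConfigEquiv hab).apply_symm_apply fun v : {v // v ∈ s(a, b)} => z v

theorem pairVec_pairConfigEquiv (hab : a ≠ b) (B : Matrix κ κ R) (i j : κ) :
    pairVec a b B (pairConfigEquiv hab (i, j)) = B i j := by
  simp [pairVec, pairConfigEquiv, hab.symm]

theorem sum_pairConfig {M : Type*} [AddCommMonoid M] [Fintype κ]
    [Fintype ({v // v ∈ s(a, b)} → κ)] (hab : a ≠ b) (f : ({v // v ∈ s(a, b)} → κ) → M) :
    ∑ w, f w = ∑ i, ∑ j, f (pairConfigEquiv hab (i, j)) := by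
  rw [← (pairConfigEquiv hab).sum_comp, Fintype.sum_prod_type]

variable [Fintype V] [Fintype κ]

theorem pairVec_vecMul_productOp [DecidableEq κ] [CommSemiring R] (hab : a ≠ b)
    (B : Matrix κ κ R) (g : V → Matrix κ κ R) :
    pairVec a b B ᵥ* productOp (fun v : {v // v ∈ s(a, b)} => g v) =
      pairVec a b ((g a)ᵀ * B * g b) := by
  funext w
  obtain ⟨⟨k, l⟩, rfl⟩ := (pairConfigEquiv hab).surjective w
  simp only [Matrix.vecMul, dotProduct, sum_pairConfig hab, pairVec_pairConfigEquiv,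
    productOp_apply, prod_pair hab, Matrix.mul_apply, Matrix.transpose_apply, Finset.sum_mul]
  rw [Finset.sum_comm]
  refine Finset.sum_congr rfl fun j _ => Finset.sum_congr rfl fun i _ => ?_
  simp only [pairConfigEquiv, Equiv.coe_fn_mk, if_pos, if_neg hab.symm]
  ring

/-- The functional on the sites `a` and `b` with coefficients `B`, applied to these two sites only,
maps `ψ` to zero. -/
def PairAnnihilates [NonUnitalNonAssocSemiring R] (a b : V) (B : Matrix κ κ R)
    (ψ : (V → κ) → R) : Prop :=
  pairVec a b B ᵥ* sliceMatrix (· ∈ s(a, b)) ψ = 0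

theorem PairAnnihilates.productOp_mulVec [DecidableEq κ] [CommSemiring R] (hab : a ≠ b)
    {B : Matrix κ κ R} {g : V → Matrix κ κ R} {ψ : (V → κ) → R}
    (h : PairAnnihilates a b ((g a)ᵀ * B * g b) ψ) :
    PairAnnihilates a b B (productOp g *ᵥ ψ) := by
  rw [PairAnnihilates, sliceMatrix_productOp_mulVec, ← Matrix.vecMul_vecMul,
    ← Matrix.vecMul_vecMul, pairVec_vecMul_productOp hab, h, Matrix.zero_vecMul]

/-- The coefficients of the two-spin singlet `|01⟩ - |10⟩`. -/
def singlet (R : Type*) [Ring R] : Matrix (Fin 2) (Fin 2) R := !![0, 1; -1, 0]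

theorem isUnit_singlet [CommRing R] : IsUnit (singlet R) := by
  simp [Matrix.isUnit_iff_isUnit_det, singlet, Matrix.det_fin_two]

theorem PairAnnihilates.swap_mem_invariantPerms [CommRing R] (hab : a ≠ b)
    {χ : (V → Fin 2) → R} (h : PairAnnihilates a b (singlet R) χ) :
    Equiv.swap a b ∈ invariantPerms χ := by
  intro x
  let slice (i j : Fin 2) : R :=
    χ (glue (· ∈ s(a, b)) (pairConfigEquiv hab (i, j)) fun v => x v)
  have hslice : slice 0 1 = slice 1 0 := by
    have h' := congrFun h fun v => x v
    simp only [Matrix.vecMul, dotProduct, sum_pairConfig hab, pairVec_pairConfigEquiv, singlet,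
      sliceMatrix, Matrix.of_apply, Fin.sum_univ_two, Matrix.cons_val_zero, Matrix.cons_val_one,
      Matrix.cons_val', Pi.zero_apply] at h'
    linear_combination h'
  have hsymm (i j : Fin 2) : slice i j = slice j i := by
    fin_cases i <;> fin_cases j <;> first | rfl | exact hslice | exact hslice.symm
  have hx : glue (· ∈ s(a, b)) (pairConfigEquiv hab (x a, x b)) (fun v => x v) = x := by
    rw [pairConfigEquiv_restrict, glue_restrict]
  have hswap : glue (· ∈ s(a, b)) (pairConfigEquiv hab (x b, x a)) (fun v => x v) =
      x ∘ Equiv.swap a b := by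
    have hpair : pairConfigEquiv hab (x b, x a) =
        fun v : {v // v ∈ s(a, b)} => (x ∘ Equiv.swap a b) v := by
      simpa using pairConfigEquiv_restrict hab (x ∘ Equiv.swap a b)
    have hrest : (fun v : {v // v ∉ s(a, b)} => x v) =
        fun v : {v // v ∉ s(a, b)} => (x ∘ Equiv.swap a b) v := by
      funext ⟨v, hv⟩
      rw [Sym2.mem_iff, not_or] at hv
      simp [Equiv.swap_apply_of_ne_of_ne hv.1 hv.2]
    rw [hpair, hrest, glue_restrict]
  calc χ (x ∘ Equiv.swap a b) = slice (x b) (x a) := by rw [← hswap]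
    _ = slice (x a) (x b) := hsymm _ _
    _ = χ x := by simp only [slice, hx]

end PairFunctionals

/-! ### Gauge transformations along a spanning tree -/

/-- A spanning tree of `G`, encoded by its root and its parent function; `depth` is any function
that certifies that iterating `parent` leads to the root. The value of `parent` at the root is
irrelevant. -/
structure RootedSpanningTree {V : Type*} (G : SimpleGraph V) where
  root : V
  parent : V → V
  depth : V → ℕ
  adj_parent : ∀ v, v ≠ root → G.Adj (parent v) v
  depth_parent_lt : ∀ v, v ≠ root → depth (parent v) < depth v

namespace RootedSpanningTree

variable {V : Type*} {G : SimpleGraph V}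

theorem nonempty_of_connected (hG : G.Connected) : Nonempty (RootedSpanningTree G) := by
  obtain ⟨r⟩ := hG.nonempty
  have hparent (v : V) : ∃ w, v ≠ r → G.Adj w v ∧ G.dist w r < G.dist v r := by
    obtain ⟨q, hq⟩ := hG.exists_walk_length_eq_dist v r
    cases q with
    | nil => exact ⟨r, fun hv => absurd rfl hv⟩
    | cons hadj q =>
      refine ⟨_, fun _ => ⟨hadj.symm, ?_⟩⟩
      rw [← hq, SimpleGraph.Walk.length_cons, Nat.lt_succ_iff]
      exact SimpleGraph.dist_le q
  choose p hp using hparent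
  exact ⟨⟨r, p, (G.dist · r), fun v hv => (hp v hv).1, fun v hv => (hp v hv).2⟩⟩

variable (T : RootedSpanningTree G)

open Classical in
/-- The labelling of the vertices that starts with `a` at the root and applies `step v` to the label
of the parent of `v` to obtain the label of `v`. -/
noncomputable def propagate {α : Type*} (a : α) (step : V → α → α) (v : V) : α :=
  if _h : v = T.root then a else step v (propagate a step (T.parent v))
termination_by T.depth v
decreasing_by exact T.depth_parent_lt v _h

theorem propagate_of_ne_root {α : Type*} (a : α) (step : V → α → α) {v : V} (h : v ≠ T.root) :
    T.propagate a step v = step v (T.propagate a step (T.parent v)) := by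
  rw [propagate, dif_neg h]

theorem exists_labelling {α : Type*} [Nonempty α] {r : V → α → α → Prop}
    (hr : ∀ v, v ≠ T.root → ∀ a, ∃ b, r v a b) :
    ∃ f : V → α, ∀ v, v ≠ T.root → r v (f (T.parent v)) (f v) := by
  have hstep (v : V) (a : α) : ∃ b, v ≠ T.root → r v a b := by
    by_cases hv : v = T.root
    · exact ⟨a, fun h => absurd hv h⟩
    · exact (hr v hv a).imp fun _ hb _ => hb
  choose step hstep using hstep
  refine ⟨T.propagate (Classical.arbitrary α) step, fun v hv => ?_⟩
  rw [T.propagate_of_ne_root _ _ hv]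
  exact hstep v _ hv

theorem exists_gauge {n R : Type*} [Fintype n] [DecidableEq n] [CommRing R] {J : Matrix n n R}
    (hJ : IsUnit J) {B : V → Matrix n n R} (hB : ∀ v, v ≠ T.root → IsUnit (B v)) :
    ∃ g : V → Matrix n n R, (∀ v, IsUnit (g v)) ∧
      ∀ v, v ≠ T.root → B v = (g (T.parent v))ᵀ * J * g v := by
  have : Nonempty {M : Matrix n n R // IsUnit M} := ⟨⟨1, isUnit_one⟩⟩
  obtain ⟨g, hg⟩ := T.exists_labelling
    (r := fun v (M N : {M : Matrix n n R // IsUnit M}) => B v = M.1ᵀ * J * N.1) fun v hv M => by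
      have hMJ : IsUnit (M.1ᵀ * J) := ((Matrix.isUnit_transpose _).2 M.2).mul hJ
      refine ⟨⟨(M.1ᵀ * J)⁻¹ * B v, (Matrix.isUnit_nonsing_inv_iff.2 hMJ).mul (hB v hv)⟩, ?_⟩
      rw [Matrix.mul_nonsing_inv_cancel_left _ _ ((Matrix.isUnit_iff_isUnit_det _).1 hMJ)]
  exact ⟨fun v => (g v).1, fun v => (g v).2, hg⟩

theorem swap_root_mem_of_swap_parent_mem [DecidableEq V] {N : Submonoid (Equiv.Perm V)}
    (hN : ∀ v, v ≠ T.root → Equiv.swap (T.parent v) v ∈ N) (v : V) :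
    Equiv.swap T.root v ∈ N := by
  induction v using (measure T.depth).wf.induction with
  | _ v ih =>
    by_cases hv : v = T.root
    · rw [hv, Equiv.swap_self]
      exact N.one_mem
    · exact SubmonoidClass.swap_mem_trans N (ih _ (T.depth_parent_lt v hv)) (hN v hv)

theorem eq_top_of_swap_parent_mem [Finite V] [DecidableEq V] {N : Submonoid (Equiv.Perm V)}
    (hN : ∀ v, v ≠ T.root → Equiv.swap (T.parent v) v ∈ N) : N = ⊤ := by
  have hroot := T.swap_root_mem_of_swap_parent_mem hN
  refine eq_top_iff.2 fun σ _ => ?_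
  induction σ using Equiv.Perm.swap_induction_on with
  | one => exact N.one_mem
  | swap_mul σ x y _ ih =>
    refine N.mul_mem (SubmonoidClass.swap_mem_trans N ?_ (hroot y)) (ih trivial)
    rw [Equiv.swap_comm]
    exact hroot x

end RootedSpanningTree

section Gauge

variable {V R : Type*} [Fintype V] [DecidableEq V] [CommRing R] {G : SimpleGraph V}
  {ψ : (V → Fin 2) → R}

theorem exists_productOp_mulVec_symmetric (hG : G.Connected)
    (hψ : ∀ a b, G.Adj a b → ∃ B, IsUnit B ∧ PairAnnihilates a b B ψ) :
    ∃ g : V → Matrix (Fin 2) (Fin 2) R,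
      (∀ v, IsUnit (g v)) ∧ invariantPerms (productOp g *ᵥ ψ) = ⊤ := by
  obtain ⟨T⟩ := RootedSpanningTree.nonempty_of_connected hG
  have hparent (v : V) : ∃ B, v ≠ T.root → IsUnit B ∧ PairAnnihilates (T.parent v) v B ψ := by
    by_cases hv : v = T.root
    · exact ⟨0, fun h => absurd hv h⟩
    · exact (hψ _ _ (T.adj_parent v hv)).imp fun _ hB _ => hB
  choose B hB using hparent
  obtain ⟨g, hg, hgB⟩ := T.exists_gauge isUnit_singlet fun v hv => (hB v hv).1
  refine ⟨g, hg, T.eq_top_of_swap_parent_mem fun v hv => ?_⟩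
  have hne : T.parent v ≠ v := (T.adj_parent v hv).ne
  exact (PairAnnihilates.productOp_mulVec hne
    (hgB v hv ▸ (hB v hv).2)).swap_mem_invariantPerms hne

theorem rank_sliceMatrix_le_of_pairAnnihilates [Nontrivial R] (hG : G.Connected)
    (hψ : ∀ a b, G.Adj a b → ∃ B, IsUnit B ∧ PairAnnihilates a b B ψ)
    (p : V → Prop) [DecidablePred p] :
    (sliceMatrix p ψ).rank ≤
      min (Fintype.card {v // p v}) (Fintype.card {v // ¬ p v}) + 1 := by
  obtain ⟨g, hg, hsymm⟩ := exists_productOp_mulVec_symmetric hG hψ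
  rw [← rank_sliceMatrix_productOp_mulVec p hg]
  exact rank_sliceMatrix_le_of_symmetric p hsymm

end Gauge

/-! ### Ground spaces -/

section GroundSpace

variable {n : Type*} [Fintype n] [DecidableEq n]

theorem mem_eigenspace_toEuclideanLin_iff {X : Matrix n n ℂ} {E : ℂ} {ψ : EuclideanSpace ℂ n} :
    ψ ∈ Module.End.eigenspace (Matrix.toEuclideanLin X) E ↔ X *ᵥ ψ.ofLp = E • ψ.ofLp := by
  rw [Module.End.mem_eigenspace_iff, Matrix.toLpLin_apply]
  exact (WithLp.ofLp_injective 2).eq_iff.symm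

theorem mem_groundSpace_iff {X : Matrix n n ℂ} {ψ : EuclideanSpace ℂ n} :
    ψ ∈ groundSpace X ↔ X *ᵥ ψ.ofLp = (groundEnergy X : ℂ) • ψ.ofLp :=
  mem_eigenspace_toEuclideanLin_iff

theorem mem_spectrum_real_iff_hasEigenvalue {X : Matrix n n ℂ} {E : ℝ} :
    E ∈ spectrum ℝ X ↔ Module.End.HasEigenvalue (Matrix.toEuclideanLin X) (E : ℂ) := by
  rw [Module.End.hasEigenvalue_iff_mem_spectrum, Matrix.spectrum_toLpLin]
  exact (spectrum.algebraMap_mem_iff ℂ).symm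

theorem mem_spectrum_real_iff_exists_mulVec_eq {X : Matrix n n ℂ} {E : ℝ} :
    E ∈ spectrum ℝ X ↔ ∃ ψ ≠ 0, X *ᵥ ψ = (E : ℂ) • ψ := by
  rw [mem_spectrum_real_iff_hasEigenvalue, Module.End.HasEigenvalue,
    Module.End.HasUnifEigenvalue, Submodule.ne_bot_iff]
  constructor
  · rintro ⟨ψ, hψ, hψ0⟩
    exact ⟨ψ.ofLp, by simpa using hψ0, mem_eigenspace_toEuclideanLin_iff.1 hψ⟩
  · rintro ⟨ψ, hψ0, hψ⟩
    exact ⟨WithLp.toLp 2 ψ, mem_eigenspace_toEuclideanLin_iff.2 hψ, by simpa using hψ0⟩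

theorem groundSpace_ne_bot [Nonempty n] {X : Matrix n n ℂ} (hX : X.IsHermitian) :
    groundSpace X ≠ ⊥ := by
  have hspectrum : (spectrum ℝ X).Nonempty := by
    rw [hX.spectrum_real_eq_range_eigenvalues]
    exact Set.range_nonempty _
  exact mem_spectrum_real_iff_hasEigenvalue.1 (hspectrum.csInf_mem Matrix.finite_real_spectrum)

end GroundSpace

/-! ### Two-spin terms -/

section ExtendPair

variable {V : Type*} [DecidableEq V] {e : Sym2 V} {h : SpinOp {v // v ∈ e}}

theorem extendPair_isHermitian [Fintype V] (hh : h.IsHermitian) :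
    (extendPair e h).IsHermitian := by
  ext x y
  have hc : (∀ v, v ∉ e → y v = x v) ↔ ∀ v, v ∉ e → x v = y v :=
    forall₂_congr fun _ _ => eq_comm
  simp only [extendPair, Matrix.conjTranspose_apply, Matrix.of_apply, hc]
  split_ifs
  · exact hh.apply _ _
  · exact star_zero ℂ

variable [Fintype V]

theorem extendPair_glue (x x' : {v // v ∈ e} → Fin 2) (y y' : {v // v ∉ e} → Fin 2) :
    extendPair e h (glue (· ∈ e) x y) (glue (· ∈ e) x' y') = if y = y' then h x x' else 0 := by
  have hagree : (∀ v, v ∉ e → glue (· ∈ e) x y v = glue (· ∈ e) x' y' v) ↔ y = y' := by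
    rw [funext_iff, Subtype.forall]
    exact forall₂_congr fun v hv => by
      rw [glue_apply_neg (· ∈ e) x y ⟨v, hv⟩, glue_apply_neg (· ∈ e) x' y' ⟨v, hv⟩]
  simp only [extendPair, Matrix.of_apply, hagree, glue_apply_pos]

theorem sliceMatrix_extendPair_mulVec (ψ : (V → Fin 2) → ℂ) :
    sliceMatrix (· ∈ e) (extendPair e h *ᵥ ψ) = h * sliceMatrix (· ∈ e) ψ := by
  ext x y
  simp only [sliceMatrix, Matrix.of_apply, Matrix.mulVec, dotProduct, Matrix.mul_apply,
    ← sum_glue (· ∈ e), extendPair_glue, ite_mul, zero_mul, Finset.sum_ite_eq, Finset.mem_univ,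
    if_true]

theorem extendPair_mulVec_eq_smul_iff {ψ : (V → Fin 2) → ℂ} {E : ℂ} :
    extendPair e h *ᵥ ψ = E • ψ ↔
      ∀ y, h *ᵥ (sliceMatrix (· ∈ e) ψ).col y = E • (sliceMatrix (· ∈ e) ψ).col y := by
  rw [← (sliceMatrix_injective (· ∈ e)).eq_iff, sliceMatrix_extendPair_mulVec]
  exact ⟨fun hψ y => funext fun x => congrFun₂ hψ x y, fun hψ => Matrix.ext fun x y =>
    congrFun (hψ y) x⟩

theorem spectrum_extendPair : spectrum ℝ (extendPair e h) = spectrum ℝ h := by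
  ext E
  simp only [mem_spectrum_real_iff_exists_mulVec_eq, extendPair_mulVec_eq_smul_iff]
  constructor
  · rintro ⟨ψ, hψ0, hψ⟩
    obtain ⟨z, hz⟩ := Function.ne_iff.1 hψ0
    refine ⟨_, fun hcol => hz ?_, hψ fun v => z v⟩
    have hzero := congrFun hcol fun v => z v
    rwa [← glue_restrict (· ∈ e) z]
  · rintro ⟨φ, hφ0, hφ⟩
    have hcol (y : {v // v ∉ e} → Fin 2) :
        (sliceMatrix (· ∈ e) fun z : V → Fin 2 => φ fun v => z v).col y = φ :=
      funext fun x => congrArg φ (funext (glue_apply_pos (· ∈ e) x y))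
    refine ⟨fun z => φ fun v => z v, fun hzero => hφ0 ?_, fun y => by rwa [hcol]⟩
    rw [← hcol 0, hzero]
    rfl

theorem mem_groundSpace_extendPair_iff {ψ : SpinSpace V} :
    ψ ∈ groundSpace (extendPair e h) ↔
      ∀ y, WithLp.toLp 2 ((sliceMatrix (· ∈ e) ψ.ofLp).col y) ∈ groundSpace h := by
  simp only [mem_groundSpace_iff, extendPair_mulVec_eq_smul_iff, groundEnergy, spectrum_extendPair]

theorem star_vecMul_sliceMatrix_eq_zero_of_mem_orthogonal {φ : SpinSpace {v // v ∈ e}}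
    (hφ : φ ∈ (groundSpace h)ᗮ) {ψ : SpinSpace V} (hψ : ψ ∈ groundSpace (extendPair e h)) :
    star φ.ofLp ᵥ* sliceMatrix (· ∈ e) ψ.ofLp = 0 := by
  funext y
  have horth := (Submodule.mem_orthogonal' _ _).1 hφ _ (mem_groundSpace_extendPair_iff.1 hψ y)
  rwa [EuclideanSpace.inner_eq_star_dotProduct, dotProduct_comm] at horth

theorem exists_eq_vecMulVec_of_det_eq_zero {k : Type*} [Field k] {X : Matrix (Fin 2) (Fin 2) k}
    (hX : X.det = 0) : ∃ u w, X = Matrix.vecMulVec u w := by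
  obtain ⟨c, hc, hcX⟩ := Matrix.exists_vecMul_eq_zero_iff.2 hX
  have hrow (j : Fin 2) : c 0 * X 0 j + c 1 * X 1 j = 0 := by
    simpa [Matrix.vecMul, dotProduct] using congrFun hcX j
  by_cases h0 : c 0 = 0
  · have h1 : c 1 ≠ 0 := fun h1 => hc (funext (Fin.forall_fin_two.2 ⟨h0, h1⟩))
    refine ⟨![1, 0], X 0, Matrix.ext fun i j => ?_⟩
    have := hrow j
    fin_cases i <;> simp_all [Matrix.vecMulVec_apply]
  · refine ⟨![-(c 1 / c 0), 1], X 1, Matrix.ext fun i j => ?_⟩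
    have := hrow j
    fin_cases i
    · simp only [Matrix.vecMulVec_apply, Fin.zero_eta, Matrix.cons_val_zero]
      field_simp
      linear_combination this
    · simp [Matrix.vecMulVec_apply]

theorem isUnit_of_not_isProductVector {a b : V} (hab : a ≠ b) {B : Matrix (Fin 2) (Fin 2) ℂ}
    (hB : ¬ IsProductVector (WithLp.toLp 2 (pairVec a b B))) : IsUnit B := by
  rw [Matrix.isUnit_iff_isUnit_det, isUnit_iff_ne_zero]
  intro hdet
  obtain ⟨u, w, rfl⟩ := exists_eq_vecMulVec_of_det_eq_zero hdet
  refine hB ⟨fun v => if (v : V) = a then u else w, fun x => ?_⟩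
  simp only [prod_pair hab, if_true, hab.symm, if_false]
  rfl

theorem exists_pairAnnihilates_of_mem_groundSpace {a b : V} (hab : a ≠ b)
    {h : SpinOp {v // v ∈ s(a, b)}} (hent : ∃ φ ∈ (groundSpace h)ᗮ, ¬ IsProductVector φ)
    {ψ : SpinSpace V} (hψ : ψ ∈ groundSpace (extendPair s(a, b) h)) :
    ∃ B, IsUnit B ∧ PairAnnihilates a b B ψ.ofLp := by
  obtain ⟨φ, hφ, hprod⟩ := hent
  obtain ⟨B, hB⟩ := pairVec_surjective hab φ.ofLp
  have hunit : IsUnit B := isUnit_of_not_isProductVector hab (by rwa [hB])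
  refine ⟨B.map star, hunit.map (starRingEnd ℂ).mapMatrix, ?_⟩
  have hstar : pairVec a b (B.map star) = star φ.ofLp := by
    rw [← hB]
    rfl
  rw [PairAnnihilates, hstar]
  exact star_vecMul_sliceMatrix_eq_zero_of_mem_orthogonal hφ hψ

end ExtendPair

/-! ### Entropy, Schmidt rank and ensembles -/

section Entropy

theorem sum_negMulLog_le_log_card {ι : Type*} {s : Finset ι} {p : ι → ℝ}
    (hp : ∀ i ∈ s, 0 ≤ p i) (hsum : ∑ i ∈ s, p i = 1) :
    ∑ i ∈ s, (p i).negMulLog ≤ Real.log s.card := by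
  have hs : s.Nonempty := Finset.nonempty_of_sum_ne_zero (hsum ▸ one_ne_zero)
  have hcard : (0 : ℝ) < s.card := by exact_mod_cast hs.card_pos
  have hjensen := Real.concaveOn_negMulLog.le_map_sum (t := s) (w := fun _ => (s.card : ℝ)⁻¹)
    (p := p) (fun _ _ => by positivity) (by simp [hcard.ne']) hp
  rw [← Finset.smul_sum, ← Finset.smul_sum, hsum, smul_eq_mul, smul_eq_mul, mul_one,
    Real.negMulLog, Real.log_inv, neg_mul_neg] at hjensen
  exact le_of_mul_le_mul_left hjensen (inv_pos.2 hcard)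

open scoped ComplexOrder in
theorem vonNeumannEntropy_le_logb_of_rank_le {n : Type*} [Fintype n] [DecidableEq n]
    {σ : Matrix n n ℂ} (hσ : σ.PosSemidef) (htrace : σ.trace = 1) {k : ℕ} (hk : σ.rank ≤ k) :
    vonNeumannEntropy hσ.isHermitian ≤ Real.logb 2 k := by
  set p := hσ.isHermitian.eigenvalues with hp
  let s : Finset n := {i | p i ≠ 0}
  have hsum : ∑ i ∈ s, p i = 1 := by
    have h : ((∑ i, p i : ℝ) : ℂ) = 1 := by
      rw [Complex.ofReal_sum, ← htrace]
      exact hσ.isHermitian.trace_eq_sum_eigenvalues.symm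
    rw [Finset.sum_filter_ne_zero]
    exact_mod_cast h
  have hentropy : vonNeumannEntropy hσ.isHermitian =
      (∑ i ∈ s, (p i).negMulLog) / Real.log 2 := by
    rw [vonNeumannEntropy, Finset.sum_div, Finset.sum_filter]
    refine Finset.sum_congr rfl fun i _ => ?_
    split_ifs with hi
    · rw [← hp, Real.negMulLog, Real.logb]
      ring
    · simp [← hp, not_not.1 hi]
  have hs : 0 < s.card := (Finset.nonempty_of_sum_ne_zero (hsum ▸ one_ne_zero)).card_pos
  have hsk : s.card ≤ k := by
    rwa [hσ.isHermitian.rank_eq_card_non_zero_eigs, Fintype.card_subtype] at hk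
  rw [hentropy, Real.logb]
  refine div_le_div_of_nonneg_right ?_ (Real.log_nonneg one_le_two)
  calc ∑ i ∈ s, (p i).negMulLog ≤ Real.log s.card :=
        sum_negMulLog_le_log_card (fun i _ => hσ.eigenvalues_nonneg i) hsum
    _ ≤ Real.log k := Real.log_le_log (by exact_mod_cast hs) (by exact_mod_cast hsk)

variable {V : Type*} [Fintype V] [DecidableEq V]

theorem trace_reducedState (A : Finset V) (ψ : SpinSpace V) :
    (reducedState A ψ).trace = (‖ψ‖ ^ 2 : ℝ) := by
  calc (reducedState A ψ).trace = ∑ z, ψ z * star (ψ z) :=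
        sum_glue (· ∈ A) fun z => ψ z * star (ψ z)
    _ = (‖ψ‖ ^ 2 : ℝ) := by
      rw [EuclideanSpace.norm_sq_eq]
      push_cast
      exact Finset.sum_congr rfl fun z _ => Complex.mul_conj' _

open scoped ComplexOrder in
theorem entanglementEntropy_le_logb_of_rank_le (A : Finset V) {ψ : SpinSpace V} (hψ : ‖ψ‖ = 1)
    {k : ℕ} (hk : (coeffMatrix A ψ).rank ≤ k) : entanglementEntropy A ψ ≤ Real.logb 2 k := by
  have htrace : (reducedState A ψ).trace = 1 := by simp [trace_reducedState, hψ]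
  exact vonNeumannEntropy_le_logb_of_rank_le (Matrix.posSemidef_self_mul_conjTranspose _) htrace
    ((Matrix.rank_mul_le_left _ _).trans hk)

theorem maximallyMixed_eq_sum_pureState {n ι : Type*} [Fintype n] [DecidableEq n] [Fintype ι]
    {M : Submodule ℂ (EuclideanSpace ℂ n)} (b : OrthonormalBasis ι ℂ M) :
    maximallyMixed M =
      ∑ i, (Module.finrank ℂ M : ℂ)⁻¹ • pureState (b i : EuclideanSpace ℂ n) := by
  rw [maximallyMixed, b.starProjection_eq_sum_rankOne, ContinuousLinearMap.toLinearMap_sum,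
    map_sum, Finset.smul_sum]
  refine Finset.sum_congr rfl fun i _ => ?_
  rw [InnerProductSpace.symm_toEuclideanLin_rankOne]
  rfl

/-- The ensemble of the vectors of an orthonormal basis of `M` with equal probabilities, which
realizes the maximally mixed state over `M`. -/
noncomputable def uniformEnsemble (M : Submodule ℂ (SpinSpace V)) [Nontrivial M] :
    PureEnsemble (maximallyMixed M) where
  size := Module.finrank ℂ M
  prob _ := (Module.finrank ℂ M : ℝ)⁻¹
  vec i := stdOrthonormalBasis ℂ M i
  prob_nonneg _ := by positivity
  sum_prob := by simp [(Module.finrank_pos (R := ℂ) (M := M)).ne']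
  norm_vec := (stdOrthonormalBasis ℂ M).orthonormal.1
  mixture := by
    rw [maximallyMixed_eq_sum_pureState (stdOrthonormalBasis ℂ M)]
    push_cast
    rfl

theorem entanglementOfFormation_maximallyMixed_le (A : Finset V)
    (M : Submodule ℂ (SpinSpace V)) [Nontrivial M] {r : ℝ}
    (hr : ∀ ψ ∈ M, ‖ψ‖ = 1 → entanglementEntropy A ψ ≤ r) :
    entanglementOfFormation A (maximallyMixed M) ≤ r := by
  let e := uniformEnsemble M
  refine (iInf_le _ e).trans (EReal.coe_le_coe_iff.2 ?_)
  calc ∑ i, e.prob i * entanglementEntropy A (e.vec i) ≤ ∑ i, e.prob i * r :=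
        Finset.sum_le_sum fun i _ => mul_le_mul_of_nonneg_left
          (hr _ (stdOrthonormalBasis ℂ M i).2 (e.norm_vec i)) (e.prob_nonneg i)
    _ = r := by rw [← Finset.sum_mul, e.sum_prob, one_mul]

end Entropy

namespace PairHamiltonian

variable {V : Type*} [Fintype V] [DecidableEq V] {G : SimpleGraph V} [DecidableRel G.Adj]
  (H : PairHamiltonian G)

theorem total_isHermitian : H.total.IsHermitian :=
  isSelfAdjoint_sum _ fun e _ => extendPair_isHermitian (H.isHermitian e)

theorem rank_coeffMatrix_le (hn : H.IsNatural) (hu : H.IsUnfrustrated) {ψ : SpinSpace V}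
    (hψ : ψ ∈ groundSpace H.total) (A : Finset V) :
    (coeffMatrix A ψ).rank ≤ min A.card Aᶜ.card + 1 := by
  have hrank := rank_sliceMatrix_le_of_pairAnnihilates (ψ := ψ.ofLp) hn.connected
    (fun a b hab => exists_pairAnnihilates_of_mem_groundSpace hab.ne
      (hn.entangled ⟨s(a, b), hab⟩) (hu ⟨s(a, b), hab⟩ hψ)) (· ∈ A)
  rwa [Fintype.card_coe, Fintype.card_subtype_compl, Fintype.card_coe, ← Finset.card_compl]
    at hrank

theorem entanglementOfFormation_groundState_le (hn : H.IsNatural) (hu : H.IsUnfrustrated)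
    (A : Finset V) :
    entanglementOfFormation A H.groundState ≤
      (Real.logb 2 ((min A.card Aᶜ.card : ℕ) + 1) : ℝ) := by
  have : Nontrivial (groundSpace H.total) :=
    Submodule.nontrivial_iff_ne_bot.2 (groundSpace_ne_bot H.total_isHermitian)
  refine entanglementOfFormation_maximallyMixed_le A _ fun ψ hψ hnorm => ?_
  exact_mod_cast entanglementEntropy_le_logb_of_rank_le A hnorm (H.rank_coeffMatrix_le hn hu hψ A)

end PairHamiltonian

end SpinLattice

theorem mainTheorem1 (c K : ℝ) (hc : 0 < c) (hK : 0 < K) :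
    ∃ C : ℝ, 0 < C ∧
      ∀ (V : Type*) [Fintype V] [DecidableEq V] (G : SimpleGraph V) [DecidableRel G.Adj],
        SpinLattice.IsoperimetricBound G c K →
        ∀ H : SpinLattice.PairHamiltonian G, H.IsNatural → H.IsUnfrustrated →
          ∀ A : Finset V,
            SpinLattice.entanglementOfFormation A H.groundState ≤
              ((C * (SpinLattice.boundaryArea G A : ℝ) : ℝ) : EReal) := by
  refine ⟨SpinLattice.areaLawConst c K, SpinLattice.areaLawConst_pos hc hK, ?_⟩
  intro V _ _ G _ hG H hn hu A
  exact (H.entanglementOfFormation_groundState_le hn hu A).trans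
    (EReal.coe_le_coe_iff.2 (hG.logb_min_card_add_one_le hc hK A))
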